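/- A \emph{modal algebra} is a Boolean algebra with a unary operation $\square$ satisfying $\square 1=1$ and $\square(a\wedge b)=\square a\wedge\square b$. It is a \emph{closure algebra} ($\mathsf{S4}$) if $\square a\le a$ and $\square a\le\square\square a$ for all $a$, and a \emph{$\mathsf{GRZ}$-algebra} if moreover $\square(\square(a\to\square a)\to a)\le a$ for all $a$, where $a\to b:=\neg a\vee b$. A \emph{modal rule} $\Gamma/\Delta$ is a pair of finite sets of modal formulae. It is \emph{valid} on $\mathfrak A$ (written $\mathfrak A\models\Gamma/\Delta$) if every valuation in $\mathfrak A$ that sends all $\gamma\in\Gamma$ to $1$ sends some $\delta\in\Delta$ to $1$. A \emph{universal class} is a class of algebras closed under isomorphic copies, subalgebras and ultraproducts, and $\mathsf{Uni}(\mathcal K)$ is the least universal class containing $\mathcal K$. For a closure algebra $\mathfrak A$, let $\rho\mathfrak A$ be the Heyting algebra of its open elements $\{a:\square a=a\}$, with the lattice operations of $\mathfrak A$ and implication $\square(\neg a\vee b)$. For a Heyting algebra $\mathfrak H$, let $\sigma\mathfrak H$ be the free Boolean extension $B(\mathfrak H)$ of $\mathfrak H$ with $\square a:=\bigvee\{b\in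 H: b\le a\}$. For a universal class $\mathcal W$ of closure algebras let $\rho\mathcal W$ be the class of isomorphic copies of the algebras $\rho\mathfrak A$, $\mathfrak A\in\mathcal W$; for a class $\mathcal V$ of Heyting algebras let $\sigma\mathcal V:=\mathsf{Uni}\{\sigma\mathfrak H:\mathfrak H\in\mathcal V\}$. A closure algebra $\mathfrak A$ is \emph{skeletal} if $\sigma\rho\mathfrak A\cong\mathfrak A$. \textbf{Theorem.} (1) For every $\mathsf{GRZ}$-algebra $\mathfrak A$ and every modal rule $\Gamma/\Delta$, $\mathfrak A\models\Gamma/\Delta$ if and only if $\sigma\rho\mathfrak A\models\Gamma/\Delta$. (2) Every universal class $\mathcal U$ of $\mathsf{GRZ}$-algebras is generated, as a universal class, by its skeletal elements; that is, $\mathcal U=\sigma\rho\,\mathcal U$, and $\mathcal U=\mathsf{Uni}\{\mathfrak A\in\mathcal U:\mathfrak A\text{ skeletal}\}$. -/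

import Mathlib

universe u v

/-! ## Modal algebras, closure algebras, GRZ-algebras -/

/-- A modal algebra: a Boolean algebra with an operator `□` such that
`□ 1 = 1` and `□ (a ∧ b) = □ a ∧ □ b`. -/
class ModalAlgebra (A : Type u) extends BooleanAlgebra A where
  box : A → A
  box_top : box ⊤ = ⊤
  box_inf : ∀ a b : A, box (a ⊓ b) = box a ⊓ box b

/-- A bundled modal algebra. -/
structure ModalAlg : Type (u + 1) where
  carrier : Type u
  [str : ModalAlgebra carrier]

attribute [instance] ModalAlg.str

instance ModalAlg.instCoeSort : CoeSort ModalAlg.{u} (Type u) := ⟨ModalAlg.carrier⟩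

open ModalAlgebra

/-- `A` is a closure algebra (a member of `S4`): `□ a ≤ a` and `□ a ≤ □ □ a`. -/
class IsS4 (A : Type u) [ModalAlgebra A] : Prop where
  box_le : ∀ a : A, box a ≤ a
  box_le_box_box : ∀ a : A, box a ≤ box (box a)

/-- `A` is a `GRZ`-algebra: a closure algebra with `□ (□ (a → □ a) → a) ≤ a`,
where `a → b` is `¬ a ∨ b`. -/
class IsGrz (A : Type u) [ModalAlgebra A] : Prop extends IsS4 A where
  grz : ∀ a : A, box ((box (aᶜ ⊔ box a))ᶜ ⊔ a) ≤ a

/-- The class of all `GRZ`-algebras. -/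
def GRZ : Set ModalAlg.{u} := {A | IsGrz A}

/-- Homomorphisms of modal algebras (complements are automatically preserved by
homomorphisms of bounded lattices between Boolean algebras). -/
structure ModalHom (A : Type u) (B : Type v) [ModalAlgebra A] [ModalAlgebra B]
    extends BoundedLatticeHom A B where
  map_box' : ∀ a : A, toFun (box a) = box (toFun a)

/-- Two modal algebras are isomorphic. -/
def ModalAlg.IsIsomorphic (A B : ModalAlg.{u}) : Prop :=
  ∃ f : ModalHom A B, Function.Bijective f.toFun

/-! ## Modal formulae, rules and validity -/

/-- Modal formulae over a countably infinite set of variables. -/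
inductive ModalFormula : Type
  | var : ℕ → ModalFormula
  | bot : ModalFormula
  | top : ModalFormula
  | and : ModalFormula → ModalFormula → ModalFormula
  | or : ModalFormula → ModalFormula → ModalFormula
  | neg : ModalFormula → ModalFormula
  | box : ModalFormula → ModalFormula

/-- The extension of a valuation to all formulae. -/
def ModalFormula.eval {A : Type u} [ModalAlgebra A] (V : ℕ → A) : ModalFormula → A
  | .var n => V n
  | .bot => ⊥
  | .top => ⊤
  | .and φ ψ => φ.eval V ⊓ ψ.eval V
  | .or φ ψ => φ.eval V ⊔ ψ.eval V
  | .neg φ => (φ.eval V)ᶜ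
  | .box φ => ModalAlgebra.box (φ.eval V)

/-- A multi-conclusion modal rule `Γ / Δ`. -/
structure ModalRule : Type where
  premises : Finset ModalFormula
  conclusions : Finset ModalFormula

/-- Validity of a rule on a modal algebra: every valuation which sends all premises to `1`
sends some conclusion to `1`. -/
def ModalRule.Valid (r : ModalRule) (A : Type u) [ModalAlgebra A] : Prop :=
  ∀ V : ℕ → A, (∀ γ ∈ r.premises, γ.eval V = ⊤) → ∃ δ ∈ r.conclusions, δ.eval V = ⊤

/-! ## Ultraproducts and universal classes -/

section Ultraproduct

variable {ι : Type v} (F : Ultrafilter ι) (A : ι → Type u)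

/-- The underlying set of the ultraproduct: the full product modulo `F`-almost everywhere
equality. -/
def Ultraproduct : Type (max u v) := Filter.Product (F : Filter ι) A

variable {A}

/-- The class of a family in the ultraproduct. -/
def Ultraproduct.mk (x : ∀ i, A i) : Ultraproduct F A :=
  Quotient.mk (Filter.productSetoid (F : Filter ι) A) x

variable {F}

theorem Ultraproduct.mk_eq {x y : ∀ i, A i} :
    Ultraproduct.mk F x = Ultraproduct.mk F y ↔ ∀ᶠ i in (F : Filter ι), x i = y i :=
  Quotient.eq (r := Filter.productSetoid (F : Filter ι) A)

theorem Ultraproduct.ind {p : Ultraproduct F A → Prop} (h : ∀ x, p (Ultraproduct.mk F x))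
    (a : Ultraproduct F A) : p a :=
  Quotient.ind (s := Filter.productSetoid (F : Filter ι) A) h a

/-- Unary operations on the ultraproduct, computed coordinatewise. -/
def Ultraproduct.map (f : ∀ i, A i → A i) : Ultraproduct F A → Ultraproduct F A :=
  Quotient.lift (s := Filter.productSetoid (F : Filter ι) A)
    (fun x => Ultraproduct.mk F fun i => f i (x i))
    (fun _ _ h => Ultraproduct.mk_eq.2 (Filter.Eventually.mono h fun _ h' => congrArg _ h'))

/-- Binary operations on the ultraproduct, computed coordinatewise. -/
def Ultraproduct.map₂ (f : ∀ i, A i → A i → A i) :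
    Ultraproduct F A → Ultraproduct F A → Ultraproduct F A :=
  Quotient.lift₂ (s₁ := Filter.productSetoid (F : Filter ι) A)
    (s₂ := Filter.productSetoid (F : Filter ι) A)
    (fun x y => Ultraproduct.mk F fun i => f i (x i) (y i))
    (fun _ _ _ _ h h' => Ultraproduct.mk_eq.2 (by
      filter_upwards [h, h'] with i hi hi'
      rw [hi, hi']))

/-- The ultraproduct of a family of modal algebras. -/
instance Ultraproduct.instModalAlgebra [∀ i, ModalAlgebra (A i)] :
    ModalAlgebra (Ultraproduct F A) where
  sup := Ultraproduct.map₂ fun _ a b => a ⊔ b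
  inf := Ultraproduct.map₂ fun _ a b => a ⊓ b
  compl := Ultraproduct.map fun _ a => aᶜ
  top := Ultraproduct.mk F fun _ => ⊤
  bot := Ultraproduct.mk F fun _ => ⊥
  box := Ultraproduct.map fun _ a => box a
  le := fun a b => Ultraproduct.map₂ (fun _ a b => a ⊓ b) a b = a
  le_refl := Ultraproduct.ind fun x => congrArg _ (funext fun i => inf_idem _)
  le_trans := Ultraproduct.ind fun x => Ultraproduct.ind fun y => Ultraproduct.ind fun z h h' => by
    refine Ultraproduct.mk_eq.2 ?_
    filter_upwards [Ultraproduct.mk_eq.1 h, Ultraproduct.mk_eq.1 h'] with i hi hi'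
    exact inf_eq_left.2 ((inf_eq_left.1 hi).trans (inf_eq_left.1 hi'))
  le_antisymm := Ultraproduct.ind fun x => Ultraproduct.ind fun y h h' => by
    refine Ultraproduct.mk_eq.2 ?_
    filter_upwards [Ultraproduct.mk_eq.1 h, Ultraproduct.mk_eq.1 h'] with i hi hi'
    exact le_antisymm (inf_eq_left.1 hi) (inf_eq_left.1 hi')
  le_sup_left := Ultraproduct.ind fun x => Ultraproduct.ind fun y =>
    congrArg _ (funext fun i => inf_eq_left.2 le_sup_left)
  le_sup_right := Ultraproduct.ind fun x => Ultraproduct.ind fun y =>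
    congrArg _ (funext fun i => inf_eq_left.2 le_sup_right)
  sup_le := Ultraproduct.ind fun x => Ultraproduct.ind fun y => Ultraproduct.ind fun z h h' => by
    refine Ultraproduct.mk_eq.2 ?_
    filter_upwards [Ultraproduct.mk_eq.1 h, Ultraproduct.mk_eq.1 h'] with i hi hi'
    exact inf_eq_left.2 (sup_le (inf_eq_left.1 hi) (inf_eq_left.1 hi'))
  inf_le_left := Ultraproduct.ind fun x => Ultraproduct.ind fun y =>
    congrArg _ (funext fun i => inf_eq_left.2 inf_le_left)
  inf_le_right := Ultraproduct.ind fun x => Ultraproduct.ind fun y =>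
    congrArg _ (funext fun i => inf_eq_left.2 inf_le_right)
  le_inf := Ultraproduct.ind fun x => Ultraproduct.ind fun y => Ultraproduct.ind fun z h h' => by
    refine Ultraproduct.mk_eq.2 ?_
    filter_upwards [Ultraproduct.mk_eq.1 h, Ultraproduct.mk_eq.1 h'] with i hi hi'
    exact inf_eq_left.2 (le_inf (inf_eq_left.1 hi) (inf_eq_left.1 hi'))
  le_sup_inf := Ultraproduct.ind fun x => Ultraproduct.ind fun y => Ultraproduct.ind fun z =>
    congrArg _ (funext fun i => inf_eq_left.2 le_sup_inf)
  inf_compl_le_bot := Ultraproduct.ind fun x =>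
    congrArg _ (funext fun i => inf_eq_left.2 (BooleanAlgebra.inf_compl_le_bot _))
  top_le_sup_compl := Ultraproduct.ind fun x =>
    congrArg _ (funext fun i => inf_eq_left.2 (BooleanAlgebra.top_le_sup_compl _))
  le_top := Ultraproduct.ind fun x => congrArg _ (funext fun i => inf_eq_left.2 le_top)
  bot_le := Ultraproduct.ind fun x => congrArg _ (funext fun i => inf_eq_left.2 bot_le)
  box_top := congrArg (Ultraproduct.mk F) (funext fun i => box_top)
  box_inf := Ultraproduct.ind fun x => Ultraproduct.ind fun y =>
    congrArg (Ultraproduct.mk F) (funext fun i => box_inf _ _)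

end Ultraproduct

/-- A universal class of modal algebras: a class closed under isomorphic copies, subalgebras
and ultraproducts. The first two conditions are expressed together: whatever embeds into a
member is a member. -/
structure IsUniversalClass (K : Set ModalAlg.{u}) : Prop where
  of_embedding : ∀ (A B : ModalAlg.{u}) (f : ModalHom B A),
    Function.Injective f.toFun → A ∈ K → B ∈ K
  ultraproduct : ∀ (ι : Type u) (F : Ultrafilter ι) (A : ι → ModalAlg.{u}),
    (∀ i, A i ∈ K) → ModalAlg.mk (Ultraproduct F fun i => A i) ∈ K

/-- The universal class generated by `K`: the least universal class containing `K`. -/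
def uniGen (K : Set ModalAlg.{u}) : Set ModalAlg.{u} :=
  {A | ∀ W : Set ModalAlg.{u}, IsUniversalClass W → K ⊆ W → A ∈ W}

/-! ## The Heyting algebra of open elements -/

section Rho

variable (A : Type u) [ModalAlgebra A]

/-- The open elements of `A`. -/
def OpenElem : Type u := {a : A // box a = a}

variable {A}

theorem box_mono {a b : A} (h : a ≤ b) : box a ≤ box b := by
  have := box_inf a b
  rw [inf_eq_left.2 h] at this
  exact inf_eq_left.1 this.symm

theorem box_box_eq [IsS4 A] (a : A) : box (box a) = box a :=
  le_antisymm (IsS4.box_le _) (IsS4.box_le_box_box _)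

/-- The Heyting algebra of open elements of a closure algebra: the lattice operations are
those of `A`, and `a → b` is `□ (¬ a ∨ b)`. -/
instance OpenElem.instHeytingAlgebra [IsS4 A] : HeytingAlgebra (OpenElem A) where
  le a b := a.1 ≤ b.1
  le_refl a := le_refl a.1
  le_trans a b c h h' := le_trans (a := a.1) h h'
  le_antisymm a b h h' := Subtype.ext (le_antisymm h h')
  sup a b := ⟨a.1 ⊔ b.1, le_antisymm (IsS4.box_le _) (sup_le
    (a.2.symm.le.trans (box_mono le_sup_left)) (b.2.symm.le.trans (box_mono le_sup_right)))⟩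
  inf a b := ⟨a.1 ⊓ b.1, by rw [box_inf, a.2, b.2]⟩
  le_sup_left a b := le_sup_left (a := a.1)
  le_sup_right a b := le_sup_right (a := a.1)
  sup_le a b c h h' := sup_le (a := a.1) h h'
  inf_le_left a b := inf_le_left (a := a.1)
  inf_le_right a b := inf_le_right (a := a.1)
  le_inf a b c h h' := SemilatticeInf.le_inf a.1 b.1 c.1 h h'
  top := ⟨⊤, box_top⟩
  bot := ⟨⊥, le_antisymm (IsS4.box_le _) bot_le⟩
  le_top a := le_top (a := a.1)
  bot_le a := bot_le (a := a.1)
  himp a b := ⟨box (a.1ᶜ ⊔ b.1), box_box_eq _⟩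
  compl a := ⟨box (a.1ᶜ ⊔ ⊥), box_box_eq _⟩
  le_himp_iff a b c := by
    change a.1 ≤ box (b.1ᶜ ⊔ c.1) ↔ a.1 ⊓ b.1 ≤ c.1
    have key : a.1 ⊓ b.1 ≤ c.1 ↔ a.1 ≤ b.1ᶜ ⊔ c.1 := by
      rw [← le_himp_iff, himp_eq, sup_comm]
    rw [key]
    exact ⟨fun h => h.trans (IsS4.box_le _), fun h => a.2.symm.le.trans (box_mono h)⟩
  himp_bot a := rfl

end Rho

/-- `ρ A`, the Heyting algebra of open elements of the closure algebra `A`. -/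
def rho (A : ModalAlg.{u}) [IsS4 A] : HeytAlg.{u} := HeytAlg.of (OpenElem A)

/-! ## The free Boolean extension of a Heyting algebra -/

section Sigma

variable (H : Type u) [HeytingAlgebra H]

/-- The Stone embedding of `H` into the power set of its prime spectrum (prime ideals are the
complements of prime filters). -/
def stoneMap (h : H) : Set {P : Order.Ideal H // P.IsPrime} := {P | h ∉ P.1}

/-- The free Boolean extension `B(H)`, realised as the Boolean algebra of sets of prime ideals
generated by the image of the Stone embedding. -/
def freeBooleanExtension : BooleanSubalgebra (Set {P : Order.Ideal H // P.IsPrime}) :=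
  BooleanSubalgebra.closure (Set.range (stoneMap H))

variable {H}

theorem stoneMap_le_iff {a b : H} : stoneMap H a ≤ stoneMap H b ↔ a ≤ b := by
  constructor
  · intro h
    by_contra hab
    have hd : Disjoint ((Order.PFilter.principal a : Order.PFilter H) : Set H)
        ((Order.Ideal.principal b : Order.Ideal H) : Set H) := by
      rw [Set.disjoint_left]
      intro x hx hx'
      exact hab (le_trans (Order.PFilter.mem_principal.1 hx) (Order.Ideal.mem_principal.1 hx'))
    obtain ⟨J, hJ, hbJ, haJ⟩ := DistribLattice.prime_ideal_of_disjoint_filter_ideal hd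
    have ha : (⟨J, hJ⟩ : {P : Order.Ideal H // P.IsPrime}) ∈ stoneMap H a := fun hmem =>
      Set.disjoint_left.1 haJ (Order.PFilter.mem_principal.2 le_rfl) hmem
    exact h ha (hbJ (Order.Ideal.mem_principal.2 le_rfl))
  · exact fun h P hP hb => hP (P.1.lower h hb)

theorem stoneMap_inf (a b : H) : stoneMap H (a ⊓ b) = stoneMap H a ⊓ stoneMap H b := by
  ext P
  have := P.2
  constructor
  · exact fun h => ⟨fun ha => h (P.1.lower inf_le_left ha), fun hb => h (P.1.lower inf_le_right hb)⟩
  · rintro ⟨ha, hb⟩ hab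
    exact (this.mem_or_mem hab).elim ha hb

theorem stoneMap_sup (a b : H) : stoneMap H (a ⊔ b) = stoneMap H a ⊔ stoneMap H b := by
  ext P
  change a ⊔ b ∉ P.1 ↔ a ∉ P.1 ∨ b ∉ P.1
  rw [Order.Ideal.sup_mem_iff]
  tauto

theorem stoneMap_bot : stoneMap H ⊥ = ⊥ := by
  ext P
  exact ⟨fun h => h P.1.bot_mem, fun h => h.elim⟩

theorem stoneMap_top : stoneMap H ⊤ = ⊤ := by
  ext P
  exact ⟨fun _ => trivial, fun _ => P.2.top_notMem⟩

/-- The embedding of `H` into its free Boolean extension. -/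
def toFreeBooleanExtension (h : H) : freeBooleanExtension H :=
  ⟨stoneMap H h, BooleanSubalgebra.subset_closure ⟨h, rfl⟩⟩

/-- Below every element `a` of `B(H)` there is a greatest element of `H`. -/
theorem exists_greatest_below (a : freeBooleanExtension H) :
    ∃ c : H, ∀ h : H, toFreeBooleanExtension h ≤ a ↔ h ≤ c := by
  have hsub : IsSublattice (Set.range (stoneMap H)) := by
    constructor
    · rintro _ ⟨x, rfl⟩ _ ⟨y, rfl⟩
      exact ⟨x ⊔ y, stoneMap_sup x y⟩
    · rintro _ ⟨x, rfl⟩ _ ⟨y, rfl⟩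
      exact ⟨x ⊓ y, stoneMap_inf x y⟩
  obtain ⟨t, ht⟩ := (BooleanSubalgebra.mem_closure_iff_sup_sdiff hsub ⟨⊥, stoneMap_bot⟩
    ⟨⊤, stoneMap_top⟩).1 (BooleanSubalgebra.compl_mem a.2)
  have key : ∀ s : Finset (Set.range (stoneMap H) × Set.range (stoneMap H)),
      ∃ c : H, ∀ h : H, Disjoint (stoneMap H h) (s.sup fun x => x.1.1 \ x.2.1) ↔ h ≤ c := by
    classical
    intro s
    induction s using Finset.induction_on with
    | empty => exact ⟨⊤, fun h => by simp⟩
    | insert x s _ ih =>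
      obtain ⟨c, hc⟩ := ih
      obtain ⟨⟨_, p, rfl⟩, ⟨_, q, rfl⟩⟩ := x
      refine ⟨(p ⇨ q) ⊓ c, fun h => ?_⟩
      have hpq : Disjoint (stoneMap H h) (stoneMap H p \ stoneMap H q) ↔ h ≤ p ⇨ q := by
        rw [le_himp_iff, ← stoneMap_le_iff, stoneMap_inf, disjoint_iff, ← inf_sdiff_assoc,
          sdiff_eq_bot_iff]
      rw [Finset.sup_insert, disjoint_sup_right, hc, le_inf_iff]
      exact and_congr_left' hpq
  obtain ⟨c, hc⟩ := key t
  refine ⟨c, fun h => ?_⟩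
  rw [← hc, ← ht, disjoint_compl_right_iff]
  rfl

/-- The greatest element of `H` below `a`. -/
noncomputable def interiorElem (a : freeBooleanExtension H) : H :=
  (exists_greatest_below a).choose

theorem le_interiorElem_iff {a : freeBooleanExtension H} {h : H} :
    h ≤ interiorElem a ↔ toFreeBooleanExtension h ≤ a :=
  ((exists_greatest_below a).choose_spec h).symm

/-- `σ H`: the free Boolean extension of `H` with `□ a = ⋁ {b ∈ H : b ≤ a}`. -/
noncomputable instance freeBooleanExtension.instModalAlgebra :
    ModalAlgebra (freeBooleanExtension H) where
  box a := toFreeBooleanExtension (interiorElem a)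
  box_top := by
    have h : interiorElem (⊤ : freeBooleanExtension H) = ⊤ :=
      top_le_iff.1 (le_interiorElem_iff.2 le_top)
    rw [h]
    exact Subtype.ext stoneMap_top
  box_inf a b := by
    have h : interiorElem (a ⊓ b) = interiorElem a ⊓ interiorElem b :=
      eq_of_forall_le_iff fun c => by simp only [le_inf_iff, le_interiorElem_iff]
    rw [h]
    exact Subtype.ext (stoneMap_inf _ _)

/-- The operator of `σ H` is given by `□ a = ⋁ {b ∈ H : b ≤ a}`, the join being a maximum. -/
theorem isLUB_box (a : freeBooleanExtension H) :
    IsLUB {b | b ∈ Set.range (toFreeBooleanExtension (H := H)) ∧ b ≤ a} (box a) := by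
  refine IsGreatest.isLUB ⟨⟨⟨_, rfl⟩, le_interiorElem_iff.1 le_rfl⟩, ?_⟩
  rintro _ ⟨⟨h, rfl⟩, hb⟩
  exact stoneMap_le_iff.2 (le_interiorElem_iff.2 hb)

end Sigma

/-- `σ H`, the closure algebra on the free Boolean extension of `H`. -/
noncomputable def sigma (H : HeytAlg.{u}) : ModalAlg.{u} := ModalAlg.mk (freeBooleanExtension H)

/-! ## Extension to classes -/

/-- `ρ W = {ρ A : A ∈ W}`, up to isomorphism. -/
def rhoClass (W : Set ModalAlg.{u}) : Set HeytAlg.{u} :=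
  {H | ∃ (A : ModalAlg.{u}) (_ : IsS4 A), A ∈ W ∧ Nonempty (H ≃o rho A)}

/-- `σ U`, the universal class generated by `{σ H : H ∈ U}`. -/
def sigmaClass (U : Set HeytAlg.{u}) : Set ModalAlg.{u} := uniGen (sigma '' U)

/-- The skeletal closure algebras: those `A` with `σ ρ A ≅ A`. -/
def skeletalAlgebras : Set ModalAlg.{u} :=
  {A | ∃ _ : IsS4 A, ModalAlg.IsIsomorphic (sigma (rho A)) A}

/-! For a closure algebra `A` whose open elements form a copy of `H`, the Boolean subalgebra
generated by the opens is a copy of `σ H`, so `σ H` embeds in `A` (`sigmaEmbedding`). The converse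
direction uses GRZ: `A` embeds in an ultrapower of `σ H`. Hence `A` and `σ ρ A` lie in the same
universal classes. Both parts of the theorem follow, because the models of a rule form a universal
class and every `σ H` is skeletal.

The ultrapower embedding is glued from local ones, one for each finite `X ⊆ A`
(`exists_local_embedding`). Let `B` be the Boolean algebra generated by `X` and the boxes of its
members. By GRZ, every `c` lies in the closure of `quasiMax c ≤ c`, a Boolean combination of opens.
Collecting such elements over the pieces of a partition gives a core `M` with `c ⊓ M` generated by
opens and `dia c ≤ dia (c ⊓ M)` for all `c` in `B` (`exists_core`). Keep each element unchanged on
`M`; off `M`, apply a Boolean retraction onto the algebra generated by the opens, chosen to fix the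
boxes. Cofinality of `M` then makes the resulting map injective on `X` and compatible with box
there. -/

section Algebra

/-! ### Boolean algebra: adjoining elements, retractions and patching -/

theorem sup_inf_sup_of_le_compl {A : Type*} [BooleanAlgebra A] {v a b c d : A} (ha : a ≤ v)
    (hb : b ≤ vᶜ) (hc : c ≤ v) (hd : d ≤ vᶜ) : (a ⊔ b) ⊓ (c ⊔ d) = a ⊓ c ⊔ b ⊓ d := by
  have h₁ : a ⊓ d = ⊥ := disjoint_iff.1 (disjoint_compl_right.mono ha hd)
  have h₂ : b ⊓ c = ⊥ := disjoint_iff.1 (disjoint_compl_left.mono hb hc)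
  rw [inf_sup_left, inf_sup_right, inf_sup_right, h₁, h₂, bot_sup_eq, sup_bot_eq]

theorem compl_inf_eq_of_inf_eq {A : Type*} [BooleanAlgebra A] {a b y : A} (h : a ⊓ y = b ⊓ y) :
    aᶜ ⊓ y = bᶜ ⊓ y := by
  rw [inf_comm, ← sdiff_eq, inf_comm bᶜ, ← sdiff_eq, ← sdiff_inf_self_right, h,
    sdiff_inf_self_right]

/-- Membership in the Boolean subalgebra obtained by adjoining one element. -/
theorem BooleanSubalgebra.exists_of_mem_closure_insert {A : Type*} [BooleanAlgebra A] {Y : Set A}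
    {y c : A} (hc : c ∈ closure (insert y Y)) :
    ∃ c₁ ∈ closure Y, ∃ c₂ ∈ closure Y, c ⊓ y = c₁ ⊓ y ∧ c ⊓ yᶜ = c₂ ⊓ yᶜ := by
  induction hc using closure_bot_sup_induction with
  | mem x hx =>
    rcases hx with rfl | hx
    · exact ⟨⊤, top_mem, ⊥, bot_mem, by simp, by simp⟩
    · exact ⟨x, subset_closure hx, x, subset_closure hx, rfl, rfl⟩
  | bot => exact ⟨⊥, bot_mem, ⊥, bot_mem, rfl, rfl⟩
  | sup a _ b _ iha ihb =>
    obtain ⟨a₁, ha₁, a₂, ha₂, h₁, h₂⟩ := iha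
    obtain ⟨b₁, hb₁, b₂, hb₂, h₃, h₄⟩ := ihb
    exact ⟨a₁ ⊔ b₁, sup_mem ha₁ hb₁, a₂ ⊔ b₂, sup_mem ha₂ hb₂,
      by rw [inf_sup_right, inf_sup_right, h₁, h₃], by rw [inf_sup_right, inf_sup_right, h₂, h₄]⟩
  | compl a _ iha =>
    obtain ⟨a₁, ha₁, a₂, ha₂, h₁, h₂⟩ := iha
    exact ⟨a₁ᶜ, compl_mem ha₁, a₂ᶜ, compl_mem ha₂, compl_inf_eq_of_inf_eq h₁,
      compl_inf_eq_of_inf_eq h₂⟩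

/-- A partial retraction onto a Boolean subalgebra `S`, defined below `w ∈ S` and fixing
finitely many elements of `S`. -/
theorem BooleanSubalgebra.exists_relative_retraction {A : Type*} [BooleanAlgebra A]
    (S : BooleanSubalgebra A) {O : Set A} (hO : O.Finite) (hOS : O ⊆ S) :
    ∀ w ∈ S, ∃ r : A → A, r ⊥ = ⊥ ∧ (∀ a b, r (a ⊓ b) = r a ⊓ r b) ∧
      (∀ a b, r (a ⊔ b) = r a ⊔ r b) ∧ (∀ a, r a ∈ S) ∧ (∀ a, r a ≤ w) ∧
      (∀ a, w ≤ a → r a = w) ∧ ∀ o ∈ O, r o = o ⊓ w := by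
  induction O, hO using Set.Finite.induction_on with
  | empty =>
    intro w hw
    by_cases hw0 : w = ⊥
    · subst hw0
      exact ⟨fun _ => ⊥, by simp⟩
    have hd : Disjoint ((Order.PFilter.principal w : Order.PFilter A) : Set A)
        ((Order.Ideal.principal ⊥ : Order.Ideal A) : Set A) := by
      rw [Set.disjoint_left]
      intro x hx hx'
      exact hw0 (le_bot_iff.1 (le_trans (Order.PFilter.mem_principal.1 hx)
        (Order.Ideal.mem_principal.1 hx')))
    -- With nothing to fix, a prime ideal avoiding `w` gives a two-valued homomorphism onto `{⊥,
    -- w}`.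
    obtain ⟨J, hJ, -, hwJ⟩ := DistribLattice.prime_ideal_of_disjoint_filter_ideal hd
    have hwJ' : ∀ a, w ≤ a → a ∉ J := fun a ha hmem =>
      Set.disjoint_left.1 hwJ (Order.PFilter.mem_principal.2 ha) hmem
    classical
    refine ⟨fun a => if a ∈ J then ⊥ else w, by simp, fun a b => ?_, fun a b => ?_,
      fun a => ?_, fun a => ?_, fun a ha => ?_, by simp⟩
    · have h : a ⊓ b ∈ J ↔ a ∈ J ∨ b ∈ J :=
        ⟨hJ.mem_or_mem, fun h => h.elim (J.lower inf_le_left) (J.lower inf_le_right)⟩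
      by_cases ha : a ∈ J <;> by_cases hb : b ∈ J <;> simp [h, ha, hb]
    · by_cases ha : a ∈ J <;> by_cases hb : b ∈ J <;> simp [ha, hb]
    · dsimp only; split_ifs
      exacts [S.bot_mem, hw]
    · dsimp only; split_ifs
      exacts [bot_le, le_rfl]
    · simp [hwJ' a ha]
  | @insert o O _ _ ih =>
    intro w hw
    have hoS : o ∈ S := hOS (Set.mem_insert _ _)
    have ih := ih ((Set.subset_insert _ _).trans hOS)
    -- Splitting `w` along `o` and joining the two maps fixes `o` automatically: `r` sends it to its
    -- top value and `s` sends it to `⊥`.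
    obtain ⟨r, r_bot, r_inf, r_sup, r_mem, r_le, r_top, r_fix⟩ := ih (w ⊓ o) (S.inf_mem hw hoS)
    obtain ⟨s, s_bot, s_inf, s_sup, s_mem, s_le, s_top, s_fix⟩ :=
      ih (w ⊓ oᶜ) (S.inf_mem hw (S.compl_mem hoS))
    refine ⟨fun a => r a ⊔ s a, by simp [r_bot, s_bot], fun a b => ?_, fun a b => ?_,
      fun a => S.sup_mem (r_mem a) (s_mem a),
      fun a => sup_le ((r_le a).trans inf_le_left) ((s_le a).trans inf_le_left),
      fun a ha => ?_, ?_⟩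
    · simp only [r_inf, s_inf]
      exact (sup_inf_sup_of_le_compl ((r_le a).trans inf_le_right) ((s_le a).trans inf_le_right)
        ((r_le b).trans inf_le_right) ((s_le b).trans inf_le_right)).symm
    · simp only [r_sup, s_sup, sup_sup_sup_comm]
    · dsimp only
      rw [r_top a (inf_le_left.trans ha), s_top a (inf_le_left.trans ha), sup_inf_inf_compl]
    · rintro x (rfl | hx)
      · have hs : s x ⊓ s xᶜ = ⊥ := by rw [← s_inf, inf_compl_self, s_bot]
        rw [s_top _ inf_le_right, inf_eq_left.2 (s_le x)] at hs
        dsimp only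
        rw [r_top _ inf_le_right, hs, sup_bot_eq, inf_comm]
      · dsimp only
        rw [r_fix x hx, s_fix x hx, ← inf_sup_left, sup_inf_inf_compl]

theorem BooleanSubalgebra.exists_retraction {A : Type*} [BooleanAlgebra A]
    (S : BooleanSubalgebra A) {O : Set A} (hO : O.Finite) (hOS : O ⊆ S) :
    ∃ r : BoundedLatticeHom A A, (∀ a, r a ∈ S) ∧ ∀ o ∈ O, r o = o := by
  obtain ⟨r, r_bot, r_inf, r_sup, r_mem, -, r_top, r_fix⟩ :=
    S.exists_relative_retraction hO hOS ⊤ S.top_mem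
  exact ⟨⟨⟨⟨r, r_sup⟩, r_inf⟩, r_top ⊤ le_rfl, r_bot⟩, r_mem,
    fun o ho => (r_fix o ho).trans (inf_top_eq o)⟩

/-- The homomorphism which agrees with the identity on `M` and with `r` off `M`. -/
def BoundedLatticeHom.patch {A : Type*} [BooleanAlgebra A] (M : A) (r : BoundedLatticeHom A A) :
    BoundedLatticeHom A A where
  toFun a := a ⊓ M ⊔ r a ⊓ Mᶜ
  map_sup' a b := by
    rw [SupHomClass.map_sup, inf_sup_right, inf_sup_right, sup_sup_sup_comm]
  map_inf' a b := by
    rw [InfHomClass.map_inf, sup_inf_sup_of_le_compl inf_le_right inf_le_right inf_le_right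
      inf_le_right, inf_inf_distrib_right a b, inf_inf_distrib_right (r a)]
  map_top' := by simp
  map_bot' := by simp

theorem BoundedLatticeHom.patch_apply {A : Type*} [BooleanAlgebra A] (M : A)
    (r : BoundedLatticeHom A A) (a : A) : patch M r a = a ⊓ M ⊔ r a ⊓ Mᶜ := rfl

end Algebra

/-! ### The algebra generated by the opens, and local embeddings from GRZ -/

section Modal

variable {A : Type u} [ModalAlgebra A]

/-- The possibility operator. -/
def dia (a : A) : A := (box aᶜ)ᶜ

theorem dia_mono {a b : A} (h : a ≤ b) : dia a ≤ dia b :=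
  compl_le_compl (box_mono (compl_le_compl h))

theorem dia_sup (a b : A) : dia (a ⊔ b) = dia a ⊔ dia b := by
  rw [dia, compl_sup, box_inf, compl_inf]; rfl

theorem dia_bot : dia (⊥ : A) = ⊥ := by
  rw [dia, compl_bot, box_top, compl_top]

theorem le_dia [IsS4 A] (a : A) : a ≤ dia a :=
  le_compl_comm.1 (IsS4.box_le _)

theorem dia_dia [IsS4 A] (a : A) : dia (dia a) = dia a := by
  rw [dia, dia, compl_compl, box_box_eq]

variable (A) in
/-- The Boolean subalgebra generated by the open elements. -/
def openGenerated : BooleanSubalgebra A := BooleanSubalgebra.closure {a | box a = a}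

theorem mem_openGenerated_of_open {a : A} (h : box a = a) : a ∈ openGenerated A :=
  BooleanSubalgebra.subset_closure h

theorem box_mem_openGenerated [IsS4 A] (a : A) : box a ∈ openGenerated A :=
  mem_openGenerated_of_open (box_box_eq a)

/-- The points of `c` from which `c` cannot be left and re-entered. -/
def quasiMax (c : A) : A := dia c ⊓ box ((dia c)ᶜ ⊔ c)

theorem quasiMax_mem_openGenerated [IsS4 A] (c : A) : quasiMax c ∈ openGenerated A :=
  (openGenerated A).inf_mem ((openGenerated A).compl_mem (box_mem_openGenerated _))
    (box_mem_openGenerated _)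

theorem quasiMax_le [IsS4 A] (c : A) : quasiMax c ≤ c := by
  refine (inf_le_inf_left _ (IsS4.box_le _)).trans ?_
  rw [inf_sup_left, inf_compl_self, bot_sup_eq]
  exact inf_le_right

/-- The only appeal to the GRZ axiom. Since `dia` is idempotent, it suffices that `c ≤ dia (quasiMax
c)`, which is the axiom for `cᶜ` read contrapositively, with `c` enlarged to `dia c`. -/
theorem dia_le_dia_quasiMax [IsGrz A] (c : A) : dia c ≤ dia (quasiMax c) := by
  rw [← dia_dia (quasiMax c)]
  refine dia_mono ?_
  have h := le_compl_comm.1 (IsGrz.grz cᶜ)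
  refine h.trans (compl_le_compl (box_mono ?_))
  rw [quasiMax, compl_inf, sup_comm, dia, compl_compl, compl_compl, sup_comm c]
  exact sup_le_sup_left (IsS4.box_le _) _

/-- Every finitely generated Boolean subalgebra has a core `M`: the trace of the subalgebra on
`M` consists of Boolean combinations of open elements, and `M` is cofinal in each of its
members. -/
theorem exists_core [IsGrz A] {Y : Set A} (hY : Y.Finite) :
    ∀ w : A, ∃ M ≤ w, ∀ c ∈ BooleanSubalgebra.closure Y,
      c ⊓ M ∈ openGenerated A ∧ dia (c ⊓ w) ≤ dia (c ⊓ M) := by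
  induction Y, hY using Set.Finite.induction_on with
  | empty =>
    intro w
    refine ⟨quasiMax w, quasiMax_le w, fun c hc => ?_⟩
    -- Without generators the subalgebra is `{⊥, ⊤}`, so only `c = ⊤` has content.
    rw [← BooleanSubalgebra.closure_latticeClosure] at hc
    have hc' : c ∈ (⊥ : BooleanSubalgebra A) := by
      refine (BooleanSubalgebra.closure_le (L := ⊥)).2 ?_ hc
      simp
    rcases hc' with rfl | rfl
    · simp
    · simpa using ⟨quasiMax_mem_openGenerated w, dia_le_dia_quasiMax w⟩
  | @insert y Y _ _ ih =>
    intro w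
    -- On `y` and on `yᶜ` the new subalgebra has the same traces as the old one, so a core is found
    -- on each side separately.
    obtain ⟨M, hM, h⟩ := ih (w ⊓ y)
    obtain ⟨N, hN, h'⟩ := ih (w ⊓ yᶜ)
    refine ⟨M ⊔ N, sup_le (hM.trans inf_le_left) (hN.trans inf_le_left), fun c hc => ?_⟩
    obtain ⟨a, ha, b, hb, hca, hcb⟩ := BooleanSubalgebra.exists_of_mem_closure_insert hc
    have e₁ : ∀ z ≤ y, c ⊓ z = a ⊓ z := fun z hz => by
      rw [← inf_eq_right.2 hz, ← inf_assoc, hca, inf_assoc]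
    have e₂ : ∀ z ≤ yᶜ, c ⊓ z = b ⊓ z := fun z hz => by
      rw [← inf_eq_right.2 hz, ← inf_assoc, hcb, inf_assoc]
    rw [inf_sup_left, e₁ M (hM.trans inf_le_right), e₂ N (hN.trans inf_le_right)]
    refine ⟨(openGenerated A).sup_mem (h a ha).1 (h' b hb).1, ?_⟩
    rw [← sup_inf_inf_compl (x := w) (y := y), inf_sup_left, e₁ _ inf_le_right,
      e₂ _ inf_le_right, dia_sup, dia_sup]
    exact sup_le_sup (h a ha).2 (h' b hb).2

/-- A finite part of a `GRZ`-algebra embeds into the subalgebra generated by the open elements. -/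
theorem exists_local_embedding [IsGrz A] {X : Set A} (hX : X.Finite) :
    ∃ h : BoundedLatticeHom A A,
      (∀ c ∈ BooleanSubalgebra.closure (X ∪ box '' X), h c ∈ openGenerated A) ∧
      (∀ a ∈ X, ∀ b ∈ X, h a = h b → a = b) ∧ ∀ a ∈ X, h (box a) = box (h a) := by
  obtain ⟨M, -, hM⟩ := exists_core (hX.union (hX.image box)) (⊤ : A)
  obtain ⟨r, r_mem, r_fix⟩ := (openGenerated A).exists_retraction (hX.image box)
    (by rintro _ ⟨a, -, rfl⟩; exact box_mem_openGenerated a)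
  have hMS : M ∈ openGenerated A := by simpa using (hM ⊤ BooleanSubalgebra.top_mem).1
  have hX' : ∀ a ∈ X, a ∈ BooleanSubalgebra.closure (X ∪ box '' X) := fun a ha =>
    BooleanSubalgebra.subset_closure (Or.inl ha)
  have fix : ∀ a ∈ X, BoundedLatticeHom.patch M r (box a) = box a := fun a ha => by
    rw [BoundedLatticeHom.patch_apply, r_fix _ ⟨a, ha, rfl⟩, sup_inf_inf_compl]
  have dia_le : ∀ c ∈ BooleanSubalgebra.closure (X ∪ box '' X), dia c ≤
      dia (BoundedLatticeHom.patch M r c) := fun c hc => by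
    have := (hM c hc).2
    rw [inf_top_eq] at this
    exact this.trans (dia_mono le_sup_left)
  have inj : ∀ a ∈ X, ∀ b ∈ X, BoundedLatticeHom.patch M r a = BoundedLatticeHom.patch M r b →
      a ≤ b := fun a ha b hb hab => by
    -- The difference `a ⊓ bᶜ` is sent to `⊥`; its `dia` is therefore `⊥`, and so is the difference
    -- itself.
    have h := dia_le _ (BooleanSubalgebra.inf_mem (hX' a ha)
      (BooleanSubalgebra.compl_mem (hX' b hb)))
    rw [map_inf, hab, ← map_inf, inf_compl_self, map_bot, dia_bot] at h
    exact disjoint_compl_right_iff.1 (disjoint_iff_inf_le.2 ((le_dia _).trans h))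
  refine ⟨BoundedLatticeHom.patch M r, fun c hc => ?_, fun a ha b hb hab =>
    (inj a ha b hb hab).antisymm (inj b hb a ha hab.symm), fun a ha => ?_⟩
  · exact (openGenerated A).sup_mem (hM c hc).1
      ((openGenerated A).inf_mem (r_mem c) ((openGenerated A).compl_mem hMS))
  · rw [fix a ha]
    refine le_antisymm ?_ ?_
    -- The patched map is monotone and fixes `box a`, so `box a` is an open element below the image
    -- of `a`.
    · rw [← box_box_eq]
      exact box_mono ((fix a ha).ge.trans
        (OrderHomClass.mono (BoundedLatticeHom.patch M r) (IsS4.box_le a)))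
    -- The reverse inequality is cofinality of `M` in `aᶜ`, read through complements.
    · have h := dia_le _ (BooleanSubalgebra.compl_mem (hX' a ha))
      rw [map_compl', dia, dia, compl_compl, compl_compl] at h
      exact compl_le_compl_iff_le.1 h

end Modal

/-- An open element, bundled. -/
def OpenElem.mk {A : Type u} [ModalAlgebra A] (a : A) (h : box a = a) : OpenElem A := ⟨a, h⟩

/-! ### The subalgebra generated by the opens is a copy of `σ H` -/

section OpenRepresentation

variable {A : Type u} [ModalAlgebra A] [IsS4 A] {H : Type v} [HeytingAlgebra H]
  (e : H ≃o OpenElem A)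

theorem openElem_le_iff {h k : H} : (e h).1 ≤ (e k).1 ↔ h ≤ k := e.le_iff_le

theorem openElem_sup (h k : H) : (e (h ⊔ k)).1 = (e h).1 ⊔ (e k).1 :=
  congrArg Subtype.val (e.map_sup h k)

theorem openElem_inf (h k : H) : (e (h ⊓ k)).1 = (e h).1 ⊓ (e k).1 :=
  congrArg Subtype.val (e.map_inf h k)

theorem openElem_symm {a : A} (h : box a = a) : (e (e.symm (OpenElem.mk a h))).1 = a :=
  congrArg Subtype.val (e.apply_symm_apply _)

/-- Every prime ideal of the Heyting algebra of open elements is the trace of a prime ideal. -/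
theorem exists_prime_extension (P : {P : Order.Ideal H // P.IsPrime}) :
    ∃ Q : Order.Ideal A, Q.IsPrime ∧ ∀ h : H, (e h).1 ∈ Q ↔ h ∈ P.1 := by
  have hP := P.2
  have hF : Order.IsPFilter {a : A | ∃ h : H, h ∉ P.1 ∧ (e h).1 ≤ a} := by
    refine Order.IsPFilter.of_def ⟨⊤, ⊤, hP.top_notMem, le_top⟩ ?_ ?_
    · rintro a ⟨h, hh, ha⟩ b ⟨k, hk, hb⟩
      refine ⟨a ⊓ b, ⟨h ⊓ k, fun hm => (hP.mem_or_mem hm).elim hh hk, ?_⟩, inf_le_left,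
        inf_le_right⟩
      rw [openElem_inf]
      exact inf_le_inf ha hb
    · rintro a b hab ⟨h, hh, ha⟩
      exact ⟨h, hh, ha.trans hab⟩
  have hI : Order.IsIdeal {a : A | ∃ h : H, h ∈ P.1 ∧ a ≤ (e h).1} := by
    refine ⟨?_, ⟨⊥, ⊥, P.1.bot_mem, bot_le⟩, ?_⟩
    · rintro a b hab ⟨h, hh, ha⟩
      exact ⟨h, hh, hab.trans ha⟩
    · rintro a ⟨h, hh, ha⟩ b ⟨k, hk, hb⟩
      refine ⟨a ⊔ b, ⟨h ⊔ k, Order.Ideal.sup_mem hh hk, ?_⟩, le_sup_left, le_sup_right⟩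
      rw [openElem_sup]
      exact sup_le_sup ha hb
  -- An element in both would put an open outside `P` below an open inside `P`.
  have hd : Disjoint (hF.toPFilter : Set A) (hI.toIdeal : Set A) := by
    rw [Set.disjoint_left]
    rintro a ⟨h, hh, ha⟩ ⟨k, hk, hb⟩
    exact hh (P.1.lower ((openElem_le_iff e).1 (ha.trans hb)) hk)
  obtain ⟨Q, hQ, hIQ, hFQ⟩ := DistribLattice.prime_ideal_of_disjoint_filter_ideal hd
  refine ⟨Q, hQ, fun h => ⟨fun hm => ?_, fun hm => hIQ ⟨h, hm, le_rfl⟩⟩⟩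
  by_contra hh
  exact Set.disjoint_left.1 hFQ ⟨h, hh, le_rfl⟩ hm

/-- A representation of `A` by sets of prime ideals of `H`, extending the Stone embedding. -/
noncomputable def openRep : BoundedLatticeHom A (Set {P : Order.Ideal H // P.IsPrime}) where
  toFun a := {P | a ∉ (exists_prime_extension e P).choose}
  map_sup' a b := by
    ext P
    simp only [Set.mem_ofPred_eq, Order.Ideal.sup_mem_iff, Set.sup_eq_union, Set.mem_union]
    tauto
  map_inf' a b := by
    ext P
    obtain ⟨hQ, -⟩ := (exists_prime_extension e P).choose_spec
    exact ⟨fun h => ⟨fun ha => h (Order.Ideal.lower _ inf_le_left ha),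
      fun hb => h (Order.Ideal.lower _ inf_le_right hb)⟩,
      fun h hm => (hQ.mem_or_mem hm).elim h.1 h.2⟩
  map_top' := by
    ext P
    exact ⟨fun _ => trivial, fun _ => (exists_prime_extension e P).choose_spec.1.top_notMem⟩
  map_bot' := by
    ext P
    exact ⟨fun h => h (Order.Ideal.bot_mem _), fun h => h.elim⟩

theorem openRep_openElem (h : H) : openRep e (e h).1 = stoneMap H h := by
  ext P
  exact not_congr ((exists_prime_extension e P).choose_spec.2 h)

theorem openRep_mem {a : A} (ha : a ∈ openGenerated A) : openRep e a ∈ freeBooleanExtension H := by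
  have h : openGenerated A ≤ (freeBooleanExtension H).comap (openRep e) := by
    refine BooleanSubalgebra.closure_le.2 fun o ho => ?_
    have : openRep e o = stoneMap H (e.symm (OpenElem.mk o ho)) := by
      rw [← openRep_openElem e, openElem_symm]
    exact BooleanSubalgebra.subset_closure ⟨_, this.symm⟩
  exact h ha

theorem exists_openRep_eq (x : freeBooleanExtension H) : ∃ a ∈ openGenerated A, openRep e a = x := by
  have h : freeBooleanExtension H ≤ (openGenerated A).map (openRep e) := by
    refine BooleanSubalgebra.closure_le.2 ?_
    rintro _ ⟨h, rfl⟩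
    exact ⟨(e h).1, mem_openGenerated_of_open (e h).2, openRep_openElem e h⟩
  exact h x.2

/-- An element generated by opens is a finite join of differences `o \ p` of opens, and on opens the
representation is the order-reflecting Stone embedding. On all of `A` it need not be injective. -/
theorem eq_bot_of_openRep_eq_bot {a : A} (ha : a ∈ openGenerated A) (h : openRep e a = ⊥) :
    a = ⊥ := by
  have hsub : IsSublattice {a : A | box a = a} := by
    constructor
    · intro a ha b hb
      exact (OpenElem.mk a ha ⊔ OpenElem.mk b hb).2
    · intro a ha b hb
      exact (OpenElem.mk a ha ⊓ OpenElem.mk b hb).2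
  obtain ⟨t, rfl⟩ := (BooleanSubalgebra.mem_closure_iff_sup_sdiff hsub (⊥ : OpenElem A).2
    (⊤ : OpenElem A).2).1 ha
  refine le_bot_iff.1 (Finset.sup_le fun x hx => ?_)
  have hx' : x.1.1 \ x.2.1 ≤ t.sup fun x => x.1.1 \ x.2.1 :=
    Finset.le_sup (f := fun x : {a : A | box a = a} × {a : A | box a = a} => x.1.1 \ x.2.1) hx
  have h₁ := (OrderHomClass.mono (openRep e) hx').trans h.le
  obtain ⟨⟨o, ho⟩, ⟨p, hp⟩⟩ := x
  have eo := openElem_symm e ho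
  have ep := openElem_symm e hp
  change o \ p ≤ ⊥
  replace h₁ : openRep e (o \ p) ≤ ⊥ := h₁
  rw [map_sdiff', ← eo, ← ep, openRep_openElem, openRep_openElem, le_bot_iff, sdiff_eq_bot_iff,
    stoneMap_le_iff] at h₁
  rw [le_bot_iff, sdiff_eq_bot_iff, ← eo, ← ep]
  exact (openElem_le_iff e).2 h₁

theorem openRep_le_iff {a b : A} (ha : a ∈ openGenerated A) (hb : b ∈ openGenerated A) :
    openRep e a ≤ openRep e b ↔ a ≤ b := by
  refine ⟨fun h => ?_, fun h => OrderHomClass.mono (openRep e) h⟩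
  rw [← sdiff_eq_bot_iff]
  refine eq_bot_of_openRep_eq_bot e ((openGenerated A).sdiff_mem ha hb) ?_
  rw [map_sdiff', sdiff_eq_bot_iff.2 h]

theorem openRep_injOn {a b : A} (ha : a ∈ openGenerated A) (hb : b ∈ openGenerated A)
    (h : openRep e a = openRep e b) : a = b :=
  le_antisymm ((openRep_le_iff e ha hb).1 h.le) ((openRep_le_iff e hb ha).1 h.ge)

/-- Box is determined by which opens lie below an element, and the representation preserves and
reflects this on `openGenerated A`. -/
theorem box_openRep {a : A} (ha : a ∈ openGenerated A) :
    box (⟨openRep e a, openRep_mem e ha⟩ : freeBooleanExtension H) =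
      ⟨openRep e (box a), openRep_mem e (box_mem_openGenerated a)⟩ := by
  have h : interiorElem (⟨openRep e a, openRep_mem e ha⟩ : freeBooleanExtension H) =
      e.symm (OpenElem.mk (box a) (box_box_eq a)) := by
    refine eq_of_forall_le_iff fun c => ?_
    rw [le_interiorElem_iff, ← e.le_iff_le, e.apply_symm_apply]
    change stoneMap H c ≤ openRep e a ↔ (e c).1 ≤ box a
    rw [← openRep_openElem e, openRep_le_iff e (mem_openGenerated_of_open (e c).2) ha]
    exact ⟨fun h => (e c).2.symm.le.trans (box_mono h), fun h => h.trans (IsS4.box_le a)⟩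
  refine Subtype.ext ?_
  change stoneMap H (interiorElem _) = openRep e (box a)
  rw [h, ← openRep_openElem e, openElem_symm]

/-- The inverse of the representation of the subalgebra generated by the open elements. -/
noncomputable def openRepInv (x : freeBooleanExtension H) : A := (exists_openRep_eq e x).choose

theorem openRepInv_mem (x : freeBooleanExtension H) : openRepInv e x ∈ openGenerated A :=
  (exists_openRep_eq e x).choose_spec.1

theorem openRep_openRepInv (x : freeBooleanExtension H) : openRep e (openRepInv e x) = x :=
  (exists_openRep_eq e x).choose_spec.2

theorem openRepInv_eq {x : freeBooleanExtension H} {a : A} (ha : a ∈ openGenerated A)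
    (h : openRep e a = x) : openRepInv e x = a :=
  openRep_injOn e (openRepInv_mem e x) ha ((openRep_openRepInv e x).trans h.symm)

/-- The embedding of `σ H` into a closure algebra whose open elements form a copy of `H`. -/
noncomputable def sigmaEmbedding : ModalHom (freeBooleanExtension H) A where
  toFun := openRepInv e
  map_sup' x y := openRepInv_eq e
    ((openGenerated A).sup_mem (openRepInv_mem e x) (openRepInv_mem e y))
    (by rw [map_sup, openRep_openRepInv, openRep_openRepInv]; rfl)
  map_inf' x y := openRepInv_eq e
    ((openGenerated A).inf_mem (openRepInv_mem e x) (openRepInv_mem e y))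
    (by rw [map_inf, openRep_openRepInv, openRep_openRepInv]; rfl)
  map_top' := openRepInv_eq e (openGenerated A).top_mem (map_top _)
  map_bot' := openRepInv_eq e (openGenerated A).bot_mem (map_bot _)
  map_box' x := by
    refine openRepInv_eq e (box_mem_openGenerated _) ?_
    have h := box_openRep e (openRepInv_mem e x)
    have hx : (⟨openRep e (openRepInv e x), openRep_mem e (openRepInv_mem e x)⟩ :
      freeBooleanExtension H) = x := Subtype.ext (openRep_openRepInv e x)
    rw [hx] at h
    exact (congrArg Subtype.val h).symm

theorem sigmaEmbedding_injective : Function.Injective (sigmaEmbedding e).toFun := fun x y h => by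
  refine Subtype.ext ?_
  rw [← openRep_openRepInv e x, ← openRep_openRepInv e y]
  exact congrArg (openRep e) h

theorem sigmaEmbedding_surjective (hA : openGenerated A = ⊤) :
    Function.Surjective (sigmaEmbedding e).toFun := fun a => by
  have ha : a ∈ openGenerated A := hA ▸ BooleanSubalgebra.mem_top
  exact ⟨⟨openRep e a, openRep_mem e ha⟩, openRepInv_eq e ha rfl⟩

end OpenRepresentation

/-! ### Free Boolean extensions are skeletal -/

section Skeletal

variable {H : Type u} [HeytingAlgebra H]

instance freeBooleanExtension.instIsS4 : IsS4 (freeBooleanExtension H) where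
  box_le _ := le_interiorElem_iff.1 le_rfl
  box_le_box_box _ := stoneMap_le_iff.2 (le_interiorElem_iff.2 le_rfl)

theorem box_toFreeBooleanExtension (h : H) :
    box (toFreeBooleanExtension h) = toFreeBooleanExtension h :=
  le_antisymm (IsS4.box_le _) (stoneMap_le_iff.2 (le_interiorElem_iff.2 le_rfl))

theorem openGenerated_freeBooleanExtension : openGenerated (freeBooleanExtension H) = ⊤ := by
  refine top_le_iff.1 fun x _ => ?_
  obtain ⟨x, hx⟩ := x
  induction hx using BooleanSubalgebra.closure_bot_sup_induction with
  | mem x hx =>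
    obtain ⟨h, rfl⟩ := hx
    exact mem_openGenerated_of_open (box_toFreeBooleanExtension h)
  | bot => exact BooleanSubalgebra.bot_mem
  | sup a _ b _ iha ihb =>
    exact BooleanSubalgebra.sup_mem (iha trivial) (ihb trivial)
  | compl a _ iha => exact BooleanSubalgebra.compl_mem (iha trivial)

end Skeletal

theorem sigma_mem_skeletalAlgebras (H : HeytAlg.{u}) : sigma H ∈ skeletalAlgebras := by
  have hS : IsS4 (sigma H) := freeBooleanExtension.instIsS4 (H := H)
  refine ⟨hS, ?_⟩
  exact ⟨sigmaEmbedding (OrderIso.refl (OpenElem (sigma H))), sigmaEmbedding_injective _,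
    sigmaEmbedding_surjective _ openGenerated_freeBooleanExtension⟩

/-! ### Validity of rules in subalgebras and ultraproducts -/

section Validity

theorem ModalHom.eval {A : Type u} {B : Type v} [ModalAlgebra A] [ModalAlgebra B]
    (f : ModalHom A B) (V : ℕ → A) (φ : ModalFormula) :
    φ.eval (fun n => f.toFun (V n)) = f.toFun (φ.eval V) := by
  induction φ with
  | var n => rfl
  | bot => exact f.map_bot'.symm
  | top => exact f.map_top'.symm
  | and φ ψ h₁ h₂ => rw [ModalFormula.eval, h₁, h₂]; exact (f.map_inf' _ _).symm
  | or φ ψ h₁ h₂ => rw [ModalFormula.eval, h₁, h₂]; exact (f.map_sup' _ _).symm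
  | neg φ h => rw [ModalFormula.eval, h]; exact (map_compl' f.toBoundedLatticeHom _).symm
  | box φ h => rw [ModalFormula.eval, h]; exact (f.map_box' _).symm

theorem Ultraproduct.eval {ι : Type v} (F : Ultrafilter ι) (A : ι → Type u)
    [∀ i, ModalAlgebra (A i)] (V : ℕ → ∀ i, A i) (φ : ModalFormula) :
    φ.eval (fun n => Ultraproduct.mk F (V n)) =
      Ultraproduct.mk F fun i => φ.eval fun n => V n i := by
  induction φ with
  | var n => rfl
  | bot => rfl
  | top => rfl
  | and φ ψ h₁ h₂ => rw [ModalFormula.eval, h₁, h₂]; rfl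
  | or φ ψ h₁ h₂ => rw [ModalFormula.eval, h₁, h₂]; rfl
  | neg φ h => rw [ModalFormula.eval, h]; rfl
  | box φ h => rw [ModalFormula.eval, h]; rfl

theorem Ultraproduct.mk_eq_top {ι : Type v} {F : Ultrafilter ι} {A : ι → Type u}
    [∀ i, ModalAlgebra (A i)] {x : ∀ i, A i} :
    Ultraproduct.mk F x = ⊤ ↔ ∀ᶠ i in (F : Filter ι), x i = ⊤ :=
  Ultraproduct.mk_eq (y := fun _ => ⊤)

/-- The models of a modal rule form a universal class. -/
theorem isUniversalClass_valid (r : ModalRule) :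
    IsUniversalClass {A : ModalAlg.{u} | r.Valid A} where
  of_embedding A B f hf hA V hV := by
    obtain ⟨δ, hδ, h⟩ := hA (fun n => f.toFun (V n)) fun γ hγ => by
      rw [f.eval, hV γ hγ]; exact f.map_top'
    rw [f.eval] at h
    exact ⟨δ, hδ, hf (h.trans f.map_top'.symm)⟩
  ultraproduct ι F A hA V hV := by
    have hrep : ∀ n, ∃ x : ∀ i, A i, Ultraproduct.mk F x = V n := fun n =>
      Ultraproduct.ind (p := fun a => ∃ x, Ultraproduct.mk F x = a) (fun x => ⟨x, rfl⟩) (V n)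
    choose W hW using hrep
    obtain rfl : (fun n => Ultraproduct.mk F (W n)) = V := funext hW
    -- Premises and conclusions are finite in number, so a failure in the ultraproduct is a failure
    -- at a single coordinate.
    by_contra! hΔ
    have h₁ : ∀ᶠ i in (F : Filter ι), ∀ γ ∈ r.premises, (γ.eval fun n => W n i) = ⊤ := by
      refine (Filter.eventually_all_finset _).2 fun γ hγ => ?_
      rw [← Ultraproduct.mk_eq_top (F := F), ← Ultraproduct.eval]
      exact hV γ hγ
    have h₂ : ∀ᶠ i in (F : Filter ι), ∀ δ ∈ r.conclusions, ¬ (δ.eval fun n => W n i) = ⊤ := by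
      refine (Filter.eventually_all_finset _).2 fun δ hδ => ?_
      rw [Ultrafilter.eventually_not, ← Ultraproduct.mk_eq_top (F := F), ← Ultraproduct.eval]
      exact hΔ δ hδ
    obtain ⟨i, hi₁, hi₂⟩ := (h₁.and h₂).exists
    obtain ⟨δ, hδ, h⟩ := hA i (fun n => W n i) hi₁
    exact hi₂ δ hδ h

end Validity

/-! ### Gluing local embeddings into an ultrapower -/

section Generation

theorem uniGen_subset {K W : Set ModalAlg.{u}} (hW : IsUniversalClass W) (h : K ⊆ W) :
    uniGen K ⊆ W := fun _ hA => hA W hW h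

/-- A finite part of a `GRZ`-algebra embeds into `σ H`, where `H` is its algebra of open
elements. -/
theorem exists_local_sigma_embedding {A : Type u} [ModalAlgebra A] [IsGrz A] {H : Type v}
    [HeytingAlgebra H] (e : H ≃o OpenElem A) (X : Finset A) :
    ∃ f : A → freeBooleanExtension H, f ⊤ = ⊤ ∧ f ⊥ = ⊥ ∧
      ∀ a ∈ X, ∀ b ∈ X, f (a ⊓ b) = f a ⊓ f b ∧ f (a ⊔ b) = f a ⊔ f b ∧
        f (box a) = box (f a) ∧ (f a = f b → a = b) := by
  obtain ⟨h, h_mem, h_inj, h_box⟩ := exists_local_embedding (A := A) X.finite_toSet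
  have hmem : ∀ c ∈ BooleanSubalgebra.closure ((X : Set A) ∪ box '' X),
      openRep e (h c) ∈ freeBooleanExtension H := fun c hc => openRep_mem e (h_mem c hc)
  have hX : ∀ a ∈ X, a ∈ BooleanSubalgebra.closure ((X : Set A) ∪ box '' X) := fun a ha =>
    BooleanSubalgebra.subset_closure (Or.inl ha)
  have hbox : ∀ a ∈ X, box a ∈ BooleanSubalgebra.closure ((X : Set A) ∪ box '' X) := fun a ha =>
    BooleanSubalgebra.subset_closure (Or.inr ⟨a, ha, rfl⟩)
  classical
  -- The default `⊥` is harmless: every value used is at an element of the finitely generated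
  -- subalgebra.
  let f : A → freeBooleanExtension H := fun a =>
    if ha : openRep e (h a) ∈ freeBooleanExtension H then ⟨_, ha⟩ else ⊥
  have hf : ∀ c (hc : c ∈ BooleanSubalgebra.closure ((X : Set A) ∪ box '' X)),
      f c = ⟨openRep e (h c), hmem c hc⟩ := fun c hc => dif_pos (hmem c hc)
  refine ⟨f, ?_, ?_, fun a ha b hb => ⟨?_, ?_, ?_, fun hab => ?_⟩⟩
  · rw [hf ⊤ BooleanSubalgebra.top_mem]
    exact Subtype.ext (by simp)
  · rw [hf ⊥ BooleanSubalgebra.bot_mem]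
    exact Subtype.ext (by simp)
  · rw [hf a (hX a ha), hf b (hX b hb), hf _ (BooleanSubalgebra.inf_mem (hX a ha) (hX b hb))]
    exact Subtype.ext (by simp)
  · rw [hf a (hX a ha), hf b (hX b hb), hf _ (BooleanSubalgebra.sup_mem (hX a ha) (hX b hb))]
    exact Subtype.ext (by simp)
  · rw [hf a (hX a ha), hf _ (hbox a ha), box_openRep e (h_mem a (hX a ha))]
    exact Subtype.ext (congrArg (openRep e) (h_box a ha))
  · rw [hf a (hX a ha), hf b (hX b hb)] at hab
    exact h_inj a ha b hb (openRep_injOn e (h_mem a (hX a ha)) (h_mem b (hX b hb))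
      (congrArg Subtype.val hab))

/-- A `GRZ`-algebra belongs to the universal class generated by `σ H`, where `H` is its algebra
of open elements. -/
theorem mem_uniGen_sigma {A : ModalAlg.{u}} [IsGrz A] {H : HeytAlg.{u}} (e : H ≃o OpenElem A) :
    A ∈ uniGen {sigma H} := by
  classical
  intro W hW hHW
  choose f f_top f_bot hf using exists_local_sigma_embedding (A := A) e
  -- Any two given elements lie in `F`-almost all finite sets, so each local property holds in the
  -- ultrapower.
  let F : Ultrafilter (Finset A) := Ultrafilter.of Filter.atTop
  have ev : ∀ a b : A, ∀ᶠ X in (F : Filter (Finset A)), a ∈ X ∧ b ∈ X := fun a b => by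
    refine (Ultrafilter.of_le (Filter.atTop : Filter (Finset A))) ?_
    filter_upwards [Filter.eventually_ge_atTop ({a, b} : Finset A)] with X hX
    exact ⟨hX (by simp), hX (by simp)⟩
  let g : ModalHom A (Ultraproduct F fun _ : Finset A => freeBooleanExtension H) :=
    { toFun := fun a => Ultraproduct.mk F fun X => f X a
      map_sup' := fun a b => Ultraproduct.mk_eq.2 <| by
        filter_upwards [ev a b] with X hX using (hf X a hX.1 b hX.2).2.1
      map_inf' := fun a b => Ultraproduct.mk_eq.2 <| by
        filter_upwards [ev a b] with X hX using (hf X a hX.1 b hX.2).1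
      map_top' := congrArg (Ultraproduct.mk F) (funext f_top)
      map_bot' := congrArg (Ultraproduct.mk F) (funext f_bot)
      map_box' := fun a => Ultraproduct.mk_eq.2 <| by
        filter_upwards [ev a a] with X hX using (hf X a hX.1 a hX.2).2.2.1 }
  have hg : Function.Injective g.toFun := fun a b hab => by
    obtain ⟨X, hX, hX'⟩ := ((ev a b).and (Ultraproduct.mk_eq.1 hab)).exists
    exact (hf X a hX.1 b hX.2).2.2.2 hX'
  exact hW.of_embedding _ _ g hg (hW.ultraproduct (Finset A) F (fun _ => sigma H) fun _ => hHW rfl)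

/-- A universal class containing a closure algebra contains `σ H`, for `H` its algebra of open
elements. -/
theorem sigma_mem_of_mem {U : Set ModalAlg.{u}} (hU : IsUniversalClass U) {A : ModalAlg.{u}}
    [IsS4 A] (hA : A ∈ U) {H : HeytAlg.{u}} (e : H ≃o OpenElem A) : sigma H ∈ U :=
  hU.of_embedding A (sigma H) (sigmaEmbedding e) (sigmaEmbedding_injective e) hA

end Generation

theorem mainTheorem6 :
    (∀ (A : ModalAlg.{u}) [IsGrz A] (r : ModalRule),
      r.Valid A ↔ r.Valid (sigma (rho A))) ∧
    (∀ U : Set ModalAlg.{u}, IsUniversalClass U → U ⊆ GRZ →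
      U = sigmaClass (rhoClass U) ∧ U = uniGen (U ∩ skeletalAlgebras)) := by
  refine ⟨fun A _ r => ⟨fun h => ?_, fun h => ?_⟩, fun U hU hGrz => ⟨?_, ?_⟩⟩
  · exact sigma_mem_of_mem (isUniversalClass_valid r) h (H := rho A) (OrderIso.refl (OpenElem A))
  · exact uniGen_subset (isUniversalClass_valid r) (Set.singleton_subset_iff.2 h)
      (mem_uniGen_sigma (H := rho A) (OrderIso.refl (OpenElem A)))
  · refine Set.Subset.antisymm (fun A hA => ?_) (uniGen_subset hU ?_)
    · have : IsGrz A := hGrz hA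
      intro W hW hKW
      exact mem_uniGen_sigma (H := rho A) (OrderIso.refl (OpenElem A)) W hW
        (Set.singleton_subset_iff.2 (hKW ⟨rho A, ⟨A, inferInstance, hA, ⟨OrderIso.refl _⟩⟩, rfl⟩))
    · rintro _ ⟨H, ⟨A, hS, hA, ⟨e⟩⟩, rfl⟩
      exact sigma_mem_of_mem hU hA e
  · refine Set.Subset.antisymm (fun A hA => ?_) (uniGen_subset hU Set.inter_subset_left)
    have : IsGrz A := hGrz hA
    intro W hW hKW
    -- The generator used for `A` is `σ ρ A`, which is skeletal and belongs to `U` because it embeds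
    -- in `A`.
    exact mem_uniGen_sigma (H := rho A) (OrderIso.refl (OpenElem A)) W hW
      (Set.singleton_subset_iff.2 (hKW ⟨sigma_mem_of_mem hU hA (H := rho A)
        (OrderIso.refl (OpenElem A)), sigma_mem_skeletalAlgebras (rho A)⟩))
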